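/- Consider $N\ge 1$ subsystems with Hilbert spaces $\mathbb C^d$, $d\ge 1$. On each subsystem $j$ there are $M\ge1$ measurement settings with $D$ outcomes each, given by positive semidefinite operators $E^{(j)}_{mi}$ with $\sum_{i}E^{(j)}_{mi}=\mathbb 1$ for every $m$; write $x_j=(m_j,i_j)$ and $E^{(j)}_{x_j}=E^{(j)}_{m_ji_j}$. The measurements are tomographically complete: every Hermitian operator on subsystem $j$ is a real linear combination of the $E^{(j)}_{mi}$. Let $L\ge1$ and let $H=\sum_{k=1}^N H^{(k)}$, where $H^{(k)}$ is Hermitian and acts only on the subsystems in a set $\mathcal N(k)\subseteq\{1,\dots,N\}$ with $|\mathcal N(k)|\le L$. Assume also that every subsystem belongs to at most $L$ of the sets $\mathcal N(1),\dots,\mathcal N(N)$. (This is automatic when the $\mathcal N(k)$ are neighbourhoods in a graph, i.e. $l\in\mathcal N(k)\iff k\in\mathcal N(l)$.) Then there are real coefficients $h^{(k)}$ with $$H^{(k)}=\sum_{(x_j)_{j\in\mathcal N(k)}}h^{(k)}_{(x_j)_{j\in\mathcal N(k)}}\bigotimes_{j\in\mathcal N(k)}E^{(j)}_{x_j}\qquad(k=1,\dots,N).$$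 Fix any such coefficients and any $h_{\max}>0$ with $|h^{(k)}_x|\le h_{\max}$ for all $k$ and $x$ (for instance the largest absolute value of a coefficient, if the coefficients are not all zero). In a single run on a state $\rho$, the settings $m_1,\dots,m_N$ are chosen independently and uniformly from $\{1,\dots,M\}$ and the subsystems are measured, so that the record $x=(x_1,\dots,x_N)$ has probability $P_\rho[x]=M^{-N}\operatorname{tr}\bigl(\rho\,E^{(1)}_{x_1}\otimes\dots\otimes E^{(N)}_{x_N}\bigr)$. Let $$H_{[N]}(x)=\sum_{k=1}^N M^{|\mathcal N(k)|}\,h^{(k)}_{(x_j)_{j\in\mathcal N(k)}}$$ (which is $M^L\sum_k h^{(k)}$ if all $|\mathcal N(k)|=L$), let $\epsilon_s=\frac1N\min_{\rho\text{ separable}}\operatorname{tr}(H\rho)$, where the separable states are the convex combinations of product states $\rho_1\otimes\dots\otimes\rho_N$, and put $$\kappa=\frac1{\sqrt2\,M^{L}\,L\,h_{\max}}>0 .$$ For $\delta>0$ let $F_{[N]}=1$ if $H_{[N]}\le N(\epsilon_s-\delta)$ and $F_{[N]}=0$ otherwise. Then for every $\delta>0$ and every separable state $\rho$, $$P_{\rho}[F_{[N]}=1]=P_\rho\bigl[H_{[N]}\le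 N(\epsilon_s-\delta)\bigr]\le\exp\left[-N\kappa^2\delta^2\right].$$ -/

import Mathlib

open scoped BigOperators ComplexOrder

noncomputable section

namespace SingleCopy

/-- The tensor product `⨂_{j ∈ ι} B j` of operators on `ℂ^d`, as a matrix in the product basis of
`(ℂ^d)^{⊗ ι}` (basis vectors are labelled by functions `ι → Fin d`). -/
def tensorOp {ι : Type*} [Fintype ι] {d : ℕ} (B : ι → Matrix (Fin d) (Fin d) ℂ) :
    Matrix (ι → Fin d) (ι → Fin d) ℂ :=
  Matrix.of fun a b => ∏ j, B j (a j) (b j)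

/-- The operator `B ⊗ 1` on `N` subsystems, where `B` acts on the subsystems in `S`. -/
def embed {N d : ℕ} (S : Finset (Fin N)) (B : Matrix (S → Fin d) (S → Fin d) ℂ) :
    Matrix (Fin N → Fin d) (Fin N → Fin d) ℂ :=
  Matrix.of fun a b =>
    if ∀ j, j ∉ S → a j = b j then B (fun j => a j) (fun j => b j) else 0

/-- The Hamiltonian `H = ∑ k, H^(k)`, where `H^(k)` acts as `A k` on the subsystems in `nbr k`. -/
def hamiltonian {N d : ℕ} (nbr : Fin N → Finset (Fin N))
    (A : (k : Fin N) → Matrix (nbr k → Fin d) (nbr k → Fin d) ℂ) :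
    Matrix (Fin N → Fin d) (Fin N → Fin d) ℂ :=
  ∑ k, embed (nbr k) (A k)

/-- Product states `ρ_1 ⊗ ⋯ ⊗ ρ_N` of density matrices. -/
def productStates (N d : ℕ) : Set (Matrix (Fin N → Fin d) (Fin N → Fin d) ℂ) :=
  {ρ | ∃ r : Fin N → Matrix (Fin d) (Fin d) ℂ,
    (∀ j, (r j).PosSemidef ∧ (r j).trace = 1) ∧ ρ = tensorOp r}

/-- Separable states: finite convex combinations of product states. -/
def separableStates (N d : ℕ) : Set (Matrix (Fin N → Fin d) (Fin N → Fin d) ℂ) :=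
  convexHull ℝ (productStates N d)

/-- `ε_s = (1/N) min_{ρ separable} tr (H ρ)`, the least energy per particle of a separable state. -/
def sepEnergy {N d : ℕ} (H : Matrix (Fin N → Fin d) (Fin N → Fin d) ℂ) : ℝ :=
  (1 / (N : ℝ)) * sInf ((fun ρ => (H * ρ).trace.re) '' separableStates N d)

/-- `E k m i` is the operator of outcome `i` of setting `m` on subsystem `k`; for every subsystem
and every setting the operators form a POVM. -/
def IsMeasurement {N M D d : ℕ} (E : Fin N → Fin M → Fin D → Matrix (Fin d) (Fin d) ℂ) : Prop :=
  ∀ k m, (∀ i, (E k m i).PosSemidef) ∧ ∑ i, E k m i = 1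

/-- On every subsystem, each observable is a real linear combination of the `E k m i`
(which need not be linearly independent). -/
def TomographicallyComplete {N M D d : ℕ}
    (E : Fin N → Fin M → Fin D → Matrix (Fin d) (Fin d) ℂ) : Prop :=
  ∀ k, ∀ B : Matrix (Fin d) (Fin d) ℂ, B.IsHermitian →
    ∃ a : Fin M → Fin D → ℝ, B = ∑ m, ∑ i, a m i • E k m i

/-- The coefficients `h` expand every local term in products of local measurement operators:
`H^(k) = ∑ x, h^(k)_x ⨂_{j ∈ nbr k} E^(j)_{x_j}`, where `x_j = (m_j, i_j)`. -/
def IsExpansion {N M D d : ℕ} (E : Fin N → Fin M → Fin D → Matrix (Fin d) (Fin d) ℂ)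
    (nbr : Fin N → Finset (Fin N))
    (A : (k : Fin N) → Matrix (nbr k → Fin d) (nbr k → Fin d) ℂ)
    (h : (k : Fin N) → (nbr k → Fin M × Fin D) → ℝ) : Prop :=
  ∀ k, A k = ∑ x : nbr k → Fin M × Fin D,
    h k x • tensorOp fun j : nbr k => E j (x j).1 (x j).2

/-- Probability that a single run on the state `ρ` yields the record `x = ((m_1, i_1), …)`:
the settings are uniform (probability `1 / M ^ N`), and given the settings the outcomes follow the
Born rule. -/
def runProb {N M D d : ℕ} (E : Fin N → Fin M → Fin D → Matrix (Fin d) (Fin d) ℂ)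
    (ρ : Matrix (Fin N → Fin d) (Fin N → Fin d) ℂ) (x : Fin N → Fin M × Fin D) : ℝ :=
  (1 / (M : ℝ) ^ N) * (ρ * tensorOp fun j => E j (x j).1 (x j).2).trace.re

/-- Probability of a set of records in a single run on the state `ρ`. -/
def eventProb {N M D d : ℕ} (E : Fin N → Fin M → Fin D → Matrix (Fin d) (Fin d) ℂ)
    (ρ : Matrix (Fin N → Fin d) (Fin N → Fin d) ℂ) (s : Set (Fin N → Fin M × Fin D)) : ℝ :=
  ∑ x, s.indicator (runProb E ρ) x

/-- The energy estimator `H_[N]`, a function of the record of a run. If every neighbourhood has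
exactly `L` elements, it is `M ^ L * ∑ k, h^(k)`. -/
def estimator {N M D : ℕ} (nbr : Fin N → Finset (Fin N))
    (h : (k : Fin N) → (nbr k → Fin M × Fin D) → ℝ) (x : Fin N → Fin M × Fin D) : ℝ :=
  ∑ k, (M : ℝ) ^ (nbr k).card * h k (fun j => x j)

/-- The cost function: `1` if `H_[N] ≤ N (ε_s - δ)` and `0` otherwise. -/
def cost {N M D d : ℕ} (nbr : Fin N → Finset (Fin N))
    (A : (k : Fin N) → Matrix (nbr k → Fin d) (nbr k → Fin d) ℂ)
    (h : (k : Fin N) → (nbr k → Fin M × Fin D) → ℝ) (δ : ℝ) (x : Fin N → Fin M × Fin D) : ℕ :=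
  if estimator nbr h x ≤ N * (sepEnergy (hamiltonian nbr A) - δ) then 1 else 0

/-- The constant of the bound: `κ² = 1 / (2 M^{2L} L² h_max²)`. -/
def kappa (M L : ℕ) (hmax : ℝ) : ℝ :=
  1 / (Real.sqrt 2 * (M : ℝ) ^ L * L * hmax)

end SingleCopy

end

namespace SingleCopy

/-- Hoeffding's lemma for a weighted average over a finite type. -/
theorem sum_mul_exp_sub_mean_le {α : Type*} [Fintype α] {p : α → ℝ} (hp : ∀ a, 0 ≤ p a)
    (hsum : ∑ a, p a = 1) {g : α → ℝ} {c : ℝ} (hg : ∀ a b, |g a - g b| ≤ c) (s : ℝ) :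
    ∑ a, p a * Real.exp (s * (g a - ∑ b, p b * g b)) ≤ Real.exp (s ^ 2 * c ^ 2 / 8) := by
  classical
  have hne : Nonempty α := by
    by_contra hne
    rw [not_nonempty_iff] at hne
    simp at hsum
  obtain ⟨a₀, ha₀⟩ := Finite.exists_min g
  have hc : 0 ≤ c := (abs_nonneg _).trans (hg a₀ a₀)
  let _ : MeasurableSpace α := ⊤
  let q : PMF α := PMF.ofFintype (fun a => ENNReal.ofReal (p a)) (by
    rw [← ENNReal.ofReal_sum_of_nonneg fun a _ => hp a, hsum, ENNReal.ofReal_one])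
  have hq : ∀ f : α → ℝ, ∫ a, f a ∂q.toMeasure = ∑ a, p a * f a := fun f => by
    rw [PMF.integral_eq_sum]
    exact Finset.sum_congr rfl fun a _ => by
      simp [q, PMF.ofFintype_apply, ENNReal.toReal_ofReal (hp a)]
  have key := (ProbabilityTheory.hasSubgaussianMGF_of_mem_Icc (μ := q.toMeasure) (X := g)
    (a := g a₀) (b := g a₀ + c) (measurable_from_top.aemeasurable)
    (Filter.Eventually.of_forall fun a => ⟨ha₀ a, by linarith [le_abs_self (g a - g a₀), hg a a₀]⟩)
    ).mgf_le s
  rw [ProbabilityTheory.mgf, hq, hq] at key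
  refine key.trans_eq ?_
  congr 1
  simp [abs_of_nonneg hc]
  ring

/-- The moment generating function bound behind the bounded differences inequality. -/
theorem sum_prod_mul_exp_sub_mean_le {α : Type*} [Fintype α] {n : ℕ} {c : ℝ}
    {p : Fin n → α → ℝ} (hp : ∀ j a, 0 ≤ p j a) (hsum : ∀ j, ∑ a, p j a = 1)
    {f : (Fin n → α) → ℝ}
    (hf : ∀ j x y, (∀ i, i ≠ j → x i = y i) → |f x - f y| ≤ c) (s : ℝ) :
    ∑ x, (∏ j, p j (x j)) * Real.exp (s * (f x - ∑ y, (∏ j, p j (y j)) * f y)) ≤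
      Real.exp (n * (s ^ 2 * c ^ 2 / 8)) := by
  classical
  induction n with
  | zero => simp
  | succ n ih =>
    have hcons : ∀ F : (Fin (n + 1) → α) → ℝ,
        ∑ x, F x = ∑ a, ∑ y : Fin n → α, F (Fin.cons a y) := fun F => by
      rw [← (Fin.consEquiv fun _ => α).sum_comp, Fintype.sum_prod_type]
      rfl
    have hP : ∑ y : Fin n → α, ∏ j : Fin n, p j.succ (y j) = 1 := by
      have := Finset.prod_univ_sum (fun _ : Fin n => (Finset.univ : Finset α))
        fun j a => p j.succ a
      rw [Fintype.piFinset_univ] at this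
      rw [← this]
      exact Finset.prod_eq_one fun j _ => hsum _
    have hP0 : ∀ y : Fin n → α, 0 ≤ ∏ j : Fin n, p j.succ (y j) :=
      fun y => Finset.prod_nonneg fun j _ => hp _ _
    set g : α → ℝ := fun a => ∑ y : Fin n → α, (∏ j : Fin n, p j.succ (y j)) * f (Fin.cons a y)
      with hgdef
    have hg : ∀ a b, |g a - g b| ≤ c := fun a b => by
      rw [hgdef]
      simp only
      rw [← Finset.sum_sub_distrib]
      refine (Finset.abs_sum_le_sum_abs _ _).trans ?_
      calc _ ≤ ∑ y : Fin n → α, (∏ j : Fin n, p j.succ (y j)) * c := by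
            refine Finset.sum_le_sum fun y _ => ?_
            rw [← mul_sub, abs_mul, abs_of_nonneg (hP0 y)]
            refine mul_le_mul_of_nonneg_left (hf 0 _ _ fun i hi => ?_) (hP0 y)
            obtain ⟨k, rfl⟩ := Fin.exists_succ_eq.2 hi
            simp
        _ = c := by rw [← Finset.sum_mul, hP, one_mul]
    have hmean : ∑ y, (∏ j, p j (y j)) * f y = ∑ a, p 0 a * g a := by
      rw [hcons]
      refine Finset.sum_congr rfl fun a _ => ?_
      rw [hgdef, Finset.mul_sum]
      exact Finset.sum_congr rfl fun y _ => by simp [Fin.prod_univ_succ, mul_assoc]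
    rw [hmean, hcons]
    calc _ = ∑ a, p 0 a * Real.exp (s * (g a - ∑ b, p 0 b * g b)) *
          ∑ y : Fin n → α, (∏ j : Fin n, p j.succ (y j)) *
            Real.exp (s * (f (Fin.cons a y) - g a)) := by
          refine Finset.sum_congr rfl fun a _ => ?_
          rw [Finset.mul_sum]
          refine Finset.sum_congr rfl fun y _ => ?_
          have : Real.exp (s * (f (Fin.cons a y) - ∑ b, p 0 b * g b)) =
              Real.exp (s * (g a - ∑ b, p 0 b * g b)) *
                Real.exp (s * (f (Fin.cons a y) - g a)) := by
            rw [← Real.exp_add]; congr 1; ring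
          rw [this, Fin.prod_univ_succ]
          simp only [Fin.cons_zero, Fin.cons_succ]
          ring
      _ ≤ ∑ a, p 0 a * Real.exp (s * (g a - ∑ b, p 0 b * g b)) *
          Real.exp (n * (s ^ 2 * c ^ 2 / 8)) := by
          refine Finset.sum_le_sum fun a _ => mul_le_mul_of_nonneg_left ?_
            (mul_nonneg (hp _ _) (Real.exp_pos _).le)
          refine ih (fun j => hp j.succ) (fun j => hsum j.succ) (f := fun y => f (Fin.cons a y))
            fun j x y hxy => hf j.succ _ _ fun i hi => ?_
          refine Fin.cases ?_ (fun k hk => ?_) i hi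
          · simp
          · simpa using hxy k fun h => hk (h ▸ rfl)
      _ ≤ Real.exp (s ^ 2 * c ^ 2 / 8) * Real.exp (n * (s ^ 2 * c ^ 2 / 8)) := by
          rw [← Finset.sum_mul]
          exact mul_le_mul_of_nonneg_right
            (sum_mul_exp_sub_mean_le (hp 0) (hsum 0) hg s) (Real.exp_pos _).le
      _ = _ := by
          rw [← Real.exp_add]; congr 1; push_cast; ring

/-- The bounded differences (McDiarmid) inequality, lower tail, for product weights on a finite
type. -/
theorem sum_indicator_prod_le_exp {α : Type*} [Fintype α] {n : ℕ} (hn : 0 < n) {c : ℝ}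
    (hc : 0 < c) {p : Fin n → α → ℝ} (hp : ∀ j a, 0 ≤ p j a) (hsum : ∀ j, ∑ a, p j a = 1)
    {f : (Fin n → α) → ℝ}
    (hf : ∀ j x y, (∀ i, i ≠ j → x i = y i) → |f x - f y| ≤ c) {t : ℝ} (ht : 0 ≤ t)
    {S : Set (Fin n → α)} (hS : ∀ x ∈ S, f x ≤ ∑ y, (∏ j, p j (y j)) * f y - t) :
    ∑ x, S.indicator (fun x => ∏ j, p j (x j)) x ≤ Real.exp (-(2 * t ^ 2 / (n * c ^ 2))) := by
  classical
  have hn' : (0 : ℝ) < n := by exact_mod_cast hn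
  set s : ℝ := 4 * t / (n * c ^ 2) with hs
  have hs0 : 0 ≤ s := by positivity
  set m := ∑ y, (∏ j, p j (y j)) * f y
  have hP0 : ∀ x : Fin n → α, 0 ≤ ∏ j, p j (x j) := fun x => Finset.prod_nonneg fun j _ => hp _ _
  calc _ ≤ ∑ x : Fin n → α,
          Real.exp (-(s * t)) * ((∏ j, p j (x j)) * Real.exp (-s * (f x - m))) := by
        refine Finset.sum_le_sum fun x _ => ?_
        by_cases hx : x ∈ S
        · rw [Set.indicator_of_mem hx]
          have h1 : 1 ≤ Real.exp (-(s * t)) * Real.exp (-s * (f x - m)) := by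
            rw [← Real.exp_add]
            refine Real.one_le_exp ?_
            nlinarith [mul_nonneg hs0 (by linarith [hS x hx] : 0 ≤ m - t - f x)]
          calc _ = (∏ j, p j (x j)) * 1 := (mul_one _).symm
            _ ≤ _ := mul_le_mul_of_nonneg_left h1 (hP0 x)
            _ = _ := by ring
        · rw [Set.indicator_of_notMem hx]
          exact mul_nonneg (Real.exp_pos _).le (mul_nonneg (hP0 x) (Real.exp_pos _).le)
    _ ≤ Real.exp (-(s * t)) * Real.exp (n * ((-s) ^ 2 * c ^ 2 / 8)) := by
        rw [← Finset.mul_sum]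
        exact mul_le_mul_of_nonneg_left (sum_prod_mul_exp_sub_mean_le hp hsum hf (-s))
          (Real.exp_pos _).le
    _ = _ := by
        rw [← Real.exp_add, hs]
        congr 1
        field_simp
        ring

/-- The expectation of a function of some of the coordinates, under product weights. -/
theorem sum_prod_mul_restrict {ι α R : Type*} [Fintype ι] [DecidableEq ι] [Fintype α]
    [CommSemiring R] {p : ι → α → R} (hsum : ∀ j, ∑ a, p j a = 1) (S : Finset ι)
    (g : (S → α) → R) :
    ∑ x : ι → α, (∏ j, p j (x j)) * g (fun j => x j) =
      ∑ y : S → α, (∏ j : S, p j (y j)) * g y := by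
  rw [← (Equiv.piEquivPiSubtypeProd (· ∈ S) fun _ => α).symm.sum_comp, Fintype.sum_prod_type]
  refine Finset.sum_congr rfl fun y _ => ?_
  have hP : ∑ z : {j // j ∉ S} → α, ∏ j : {j // j ∉ S}, p j (z j) = 1 := by
    have := Finset.prod_univ_sum (fun _ : {j // j ∉ S} => (Finset.univ : Finset α))
      fun j a => p (j : ι) a
    rw [Fintype.piFinset_univ] at this
    rw [← this]
    exact Finset.prod_eq_one fun j _ => hsum _
  rw [← mul_one (∏ j : S, p j (y j)), ← hP, Finset.mul_sum, Finset.sum_mul]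
  refine Finset.sum_congr rfl fun z _ => ?_
  set w := (Equiv.piEquivPiSubtypeProd (· ∈ S) fun _ => α).symm (y, z) with hw
  have hy : ∀ j : S, w j = y j := fun j => dif_pos j.2
  have hz : ∀ j : {j // j ∉ S}, w j = z j := fun j => dif_neg j.2
  have hprod : ∏ j, p j (w j) =
      (∏ j : S, p j (y j)) * ∏ j : {j // j ∉ S}, p j (z j) := by
    rw [← Fintype.prod_subtype_mul_prod_subtype (· ∈ S)]
    refine congr_arg₂ _ (Finset.prod_congr (by ext; simp) fun j _ => ?_)
      (Finset.prod_congr (by ext; simp) fun j _ => ?_)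
    · exact congr_arg _ (hy j)
    · exact congr_arg _ (hz j)
  rw [hprod, funext hy]

theorem trace_mul_nonneg_of_posSemidef {n : Type*} [Fintype n] {A B : Matrix n n ℂ}
    (hA : A.PosSemidef) (hB : B.PosSemidef) : 0 ≤ (A * B).trace := by
  classical
  obtain ⟨C, rfl⟩ : ∃ C : Matrix n n ℂ, B = C.conjTranspose * C := by
    open scoped MatrixOrder in
    exact CStarAlgebra.nonneg_iff_eq_star_mul_self.mp hB.nonneg
  rw [← Matrix.mul_assoc, Matrix.trace_mul_comm, ← Matrix.mul_assoc]
  exact (hA.mul_mul_conjTranspose_same C).trace_nonneg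

section tensorOp

variable {ι : Type*} [Fintype ι] {d : ℕ}

theorem tensorOp_mul [DecidableEq ι] (A B : ι → Matrix (Fin d) (Fin d) ℂ) :
    tensorOp A * tensorOp B = tensorOp fun j => A j * B j := by
  ext a b
  simp only [tensorOp, Matrix.mul_apply, Matrix.of_apply]
  rw [Finset.prod_univ_sum, Fintype.piFinset_univ]
  exact Finset.sum_congr rfl fun x _ => Finset.prod_mul_distrib.symm

theorem trace_tensorOp [DecidableEq ι] (A : ι → Matrix (Fin d) (Fin d) ℂ) :
    (tensorOp A).trace = ∏ j, (A j).trace := by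
  simp only [tensorOp, Matrix.trace, Matrix.diag_apply, Matrix.of_apply]
  rw [Finset.prod_univ_sum, Fintype.piFinset_univ]

theorem isHermitian_tensorOp {A : ι → Matrix (Fin d) (Fin d) ℂ} (hA : ∀ j, (A j).IsHermitian) :
    (tensorOp A).IsHermitian := by
  ext a b
  simp only [tensorOp, Matrix.conjTranspose_apply, Matrix.of_apply, star_prod]
  exact Finset.prod_congr rfl fun j _ => (hA j).apply _ _

/-- The tensor product is multilinear. -/
theorem tensorOp_sum_smul [DecidableEq ι] {α : Type*} [Fintype α] (c : ι → α → ℂ)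
    (B : ι → α → Matrix (Fin d) (Fin d) ℂ) :
    (tensorOp fun j => ∑ a, c j a • B j a) =
      ∑ x : ι → α, (∏ j, c j (x j)) • tensorOp fun j => B j (x j) := by
  ext a b
  simp only [tensorOp, Matrix.of_apply, Matrix.sum_apply, Matrix.smul_apply, smul_eq_mul]
  rw [Finset.prod_univ_sum, Fintype.piFinset_univ]
  exact Finset.sum_congr rfl fun x _ => Finset.prod_mul_distrib

theorem single_eq_tensorOp (a b : ι → Fin d) :
    Matrix.single a b (1 : ℂ) = tensorOp fun j => Matrix.single (a j) (b j) 1 := by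
  ext a' b'
  simp only [tensorOp, Matrix.of_apply, Matrix.single_apply, Finset.prod_ite_zero,
    Finset.prod_const_one, Finset.mem_univ, true_imp_iff, funext_iff, forall_and]

/-- If operators `B j x` span the Hermitian operators on every factor, then their tensor products
span the Hermitian operators on the tensor product. -/
theorem exists_eq_sum_smul_tensorOp [DecidableEq ι] {α : Type*} [Fintype α]
    {B : ι → α → Matrix (Fin d) (Fin d) ℂ} (hB : ∀ j x, (B j x).IsHermitian)
    (hspan : ∀ j, ∀ C : Matrix (Fin d) (Fin d) ℂ, C.IsHermitian → ∃ c : α → ℝ,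
      C = ∑ x, c x • B j x)
    {A : Matrix (ι → Fin d) (ι → Fin d) ℂ} (hA : A.IsHermitian) :
    ∃ h : (ι → α) → ℝ, A = ∑ x, h x • tensorOp fun j => B j (x j) := by
  have hspanC : ∀ j, ∀ C : Matrix (Fin d) (Fin d) ℂ, ∃ c : α → ℂ, C = ∑ x, c x • B j x := by
    intro j C
    obtain ⟨u, hu⟩ := hspan j (realPart C) (realPart C).2
    obtain ⟨v, hv⟩ := hspan j (imaginaryPart C) (imaginaryPart C).2
    refine ⟨fun x => u x + Complex.I * v x, ?_⟩
    conv_lhs => rw [← realPart_add_I_smul_imaginaryPart C, hu, hv]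
    simp only [add_smul, mul_smul, Finset.sum_add_distrib, Finset.smul_sum, Complex.coe_smul]
  have hall : ∀ C : Matrix (ι → Fin d) (ι → Fin d) ℂ, ∃ c : (ι → α) → ℂ,
      C = ∑ x, c x • tensorOp fun j => B j (x j) := by
    intro C
    choose c hc using fun (a b : ι → Fin d) (j : ι) => hspanC j (Matrix.single (a j) (b j) 1)
    have hsingle : ∀ a b, Matrix.single a b (1 : ℂ) =
        ∑ x : ι → α, (∏ j, c a b j (x j)) • tensorOp fun j => B j (x j) := fun a b => by
      rw [← tensorOp_sum_smul, single_eq_tensorOp]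
      exact congr_arg _ (funext fun j => hc a b j)
    refine ⟨fun x => ∑ a, ∑ b, C a b * ∏ j, c a b j (x j), ?_⟩
    calc C = ∑ a, ∑ b, C a b • Matrix.single a b (1 : ℂ) := by
          conv_lhs => rw [Matrix.matrix_eq_sum_single C]
          simp only [Matrix.smul_single, smul_eq_mul, mul_one]
      _ = ∑ a, ∑ b, ∑ x : ι → α,
          (C a b * ∏ j, c a b j (x j)) • tensorOp fun j => B j (x j) := by
          simp only [hsingle, Finset.smul_sum, smul_smul]
      _ = _ := by
          simp only [Finset.sum_smul]
          rw [Finset.sum_comm_cycle]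
  obtain ⟨c, hc⟩ := hall A
  refine ⟨fun x => (c x).re, ?_⟩
  have hc' : A = ∑ x, star (c x) • tensorOp fun j => B j (x j) := by
    rw [← hA.eq]
    conv_lhs => rw [hc]
    rw [Matrix.conjTranspose_sum]
    refine Finset.sum_congr rfl fun x _ => ?_
    rw [Matrix.conjTranspose_smul, (isHermitian_tensorOp fun j => hB j (x j)).eq]
  have h2 : (2 : ℂ) • A = (2 : ℂ) • ∑ x, (c x).re • tensorOp fun j => B j (x j) := by
    rw [two_smul]
    nth_rw 1 [hc]
    rw [hc', ← Finset.sum_add_distrib, Finset.smul_sum]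
    refine Finset.sum_congr rfl fun x _ => ?_
    rw [← add_smul, ← Complex.coe_smul, smul_smul]
    congr 1
    rw [← starRingEnd_apply, Complex.add_conj]
    push_cast
    ring
  exact smul_right_injective _ (two_ne_zero' ℂ) h2

end tensorOp

section embed

variable {N d : ℕ} (S : Finset (Fin N))

theorem embed_sum_smul {α : Type*} [Fintype α] (c : α → ℝ)
    (B : α → Matrix (S → Fin d) (S → Fin d) ℂ) :
    embed S (∑ x, c x • B x) = ∑ x, c x • embed S (B x) := by
  ext a b
  simp only [embed, Matrix.of_apply, Matrix.sum_apply, Matrix.smul_apply]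
  split_ifs <;> simp

theorem prod_dite_mem_one {R : Type*} [CommMonoid R] (u : S → R) :
    ∏ j, (if hj : j ∈ S then u ⟨j, hj⟩ else 1) = ∏ j : S, u j := by
  rw [← Finset.prod_mul_prod_compl S, ← Finset.prod_coe_sort S, Finset.prod_eq_one (s := Sᶜ),
    mul_one]
  · exact Finset.prod_congr rfl fun j _ => dif_pos j.2
  · exact fun j hj => dif_neg (Finset.mem_compl.1 hj)

theorem embed_tensorOp (B : S → Matrix (Fin d) (Fin d) ℂ) :
    embed S (tensorOp B) = tensorOp fun j => if hj : j ∈ S then B ⟨j, hj⟩ else 1 := by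
  ext a b
  simp only [embed, tensorOp, Matrix.of_apply]
  split_ifs with h
  · rw [← prod_dite_mem_one]
    refine Finset.prod_congr rfl fun j _ => ?_
    split_ifs with hj
    · rfl
    · rw [h j hj, Matrix.one_apply_eq]
  · push Not at h
    obtain ⟨j, hj, hab⟩ := h
    refine (Finset.prod_eq_zero (Finset.mem_univ j) ?_).symm
    rw [dif_neg hj, Matrix.one_apply_ne hab]

theorem trace_embed_tensorOp_mul {r : Fin N → Matrix (Fin d) (Fin d) ℂ}
    (hr : ∀ j, (r j).trace = 1) (B : S → Matrix (Fin d) (Fin d) ℂ) :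
    (embed S (tensorOp B) * tensorOp r).trace = ∏ j : S, (B j * r j).trace := by
  rw [embed_tensorOp, tensorOp_mul, trace_tensorOp, ← prod_dite_mem_one]
  refine Finset.prod_congr rfl fun j _ => ?_
  split_ifs with hj
  · rfl
  · rw [Matrix.one_mul, hr]

end embed

variable {N M D d : ℕ} {E : Fin N → Fin M → Fin D → Matrix (Fin d) (Fin d) ℂ}

/-- The distribution of the record of a single subsystem in the state `r`. -/
noncomputable def localProb (E : Fin M → Fin D → Matrix (Fin d) (Fin d) ℂ)
    (r : Matrix (Fin d) (Fin d) ℂ) (x : Fin M × Fin D) : ℝ :=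
  (1 / (M : ℝ)) * (E x.1 x.2 * r).trace.re

theorem localProb_nonneg (hE : IsMeasurement E) {r : Matrix (Fin d) (Fin d) ℂ}
    (hr : r.PosSemidef) (j : Fin N) (x : Fin M × Fin D) : 0 ≤ localProb (E j) r x :=
  mul_nonneg (by positivity)
    (Complex.nonneg_iff.1 (trace_mul_nonneg_of_posSemidef ((hE j x.1).1 x.2) hr)).1

theorem sum_localProb (hM : 0 < M) (hE : IsMeasurement E) {r : Matrix (Fin d) (Fin d) ℂ}
    (hr : r.trace = 1) (j : Fin N) : ∑ x, localProb (E j) r x = 1 := by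
  have hM' : (M : ℝ) ≠ 0 := by exact_mod_cast hM.ne'
  have h : ∀ m, ∑ i, (E j m i * r).trace.re = 1 := fun m => by
    rw [← Complex.re_sum, ← Matrix.trace_sum, ← Finset.sum_mul, (hE j m).2, Matrix.one_mul, hr,
      Complex.one_re]
  simp only [localProb]
  rw [← Finset.mul_sum, Fintype.sum_prod_type]
  simp [h, hM']

theorem ofReal_localProb (hM : 0 < M) (hE : IsMeasurement E) {r : Matrix (Fin d) (Fin d) ℂ}
    (hr : r.PosSemidef) (j : Fin N) (x : Fin M × Fin D) :
    (E j x.1 x.2 * r).trace = ((M * localProb (E j) r x : ℝ) : ℂ) := by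
  have hM' : (M : ℝ) ≠ 0 := by exact_mod_cast hM.ne'
  have h := Complex.nonneg_iff.1 (trace_mul_nonneg_of_posSemidef ((hE j x.1).1 x.2) hr)
  have h' : M * localProb (E j) r x = (E j x.1 x.2 * r).trace.re := by
    rw [localProb]; field_simp
  rw [h']
  exact Complex.ext rfl (by simpa using h.2.symm)

theorem runProb_tensorOp (hM : 0 < M) (hE : IsMeasurement E)
    {r : Fin N → Matrix (Fin d) (Fin d) ℂ} (hr : ∀ j, (r j).PosSemidef)
    (x : Fin N → Fin M × Fin D) :
    runProb E (tensorOp r) x = ∏ j, localProb (E j) (r j) (x j) := by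
  have hM' : (M : ℝ) ≠ 0 := by exact_mod_cast hM.ne'
  rw [runProb, Matrix.trace_mul_comm, tensorOp_mul, trace_tensorOp]
  simp only [ofReal_localProb hM hE (hr _)]
  rw [← Complex.ofReal_prod, Complex.ofReal_re, Finset.prod_mul_distrib, Finset.prod_const,
    Finset.card_univ, Fintype.card_fin]
  field_simp

variable {nbr : Fin N → Finset (Fin N)}
  {A : (k : Fin N) → Matrix (nbr k → Fin d) (nbr k → Fin d) ℂ}
  {h : (k : Fin N) → (nbr k → Fin M × Fin D) → ℝ}

/-- On product states, the estimator is unbiased. -/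
theorem trace_hamiltonian_mul_tensorOp (hM : 0 < M) (hE : IsMeasurement E)
    (hh : IsExpansion E nbr A h) {r : Fin N → Matrix (Fin d) (Fin d) ℂ}
    (hr : ∀ j, (r j).PosSemidef ∧ (r j).trace = 1) :
    (hamiltonian nbr A * tensorOp r).trace.re =
      ∑ x, (∏ j, localProb (E j) (r j) (x j)) * estimator nbr h x := by
  simp only [estimator, Finset.mul_sum, hamiltonian, Finset.sum_mul, Matrix.trace_sum,
    Complex.re_sum]
  rw [Finset.sum_comm]
  refine Finset.sum_congr rfl fun k _ => ?_
  rw [sum_prod_mul_restrict (fun j => sum_localProb hM hE (hr j).2 j) (nbr k)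
    fun y => (M : ℝ) ^ (nbr k).card * h k y, hh k, embed_sum_smul, Finset.sum_mul,
    Matrix.trace_sum, Complex.re_sum]
  refine Finset.sum_congr rfl fun y _ => ?_
  rw [Matrix.smul_mul, Matrix.trace_smul, trace_embed_tensorOp_mul _ fun j => (hr j).2]
  simp only [ofReal_localProb hM hE (hr _).1]
  rw [← Complex.ofReal_prod, Complex.real_smul, ← Complex.ofReal_mul, Complex.ofReal_re,
    Finset.prod_mul_distrib, Finset.prod_const, Finset.card_univ, Fintype.card_coe]
  ring

theorem abs_estimator_sub_le {L : ℕ} (hM : 0 < M) (hcard : ∀ k, (nbr k).card ≤ L)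
    (hoverlap : ∀ j, (Finset.univ.filter fun k => j ∈ nbr k).card ≤ L) {hmax : ℝ}
    (hmax0 : 0 ≤ hmax) (hb : ∀ k x, |h k x| ≤ hmax) (j : Fin N) (x y : Fin N → Fin M × Fin D)
    (hxy : ∀ i, i ≠ j → x i = y i) :
    |estimator nbr h x - estimator nbr h y| ≤ 2 * (M : ℝ) ^ L * L * hmax := by
  have hM' : (1 : ℝ) ≤ M := by exact_mod_cast hM
  have hML : 0 ≤ 2 * (M : ℝ) ^ L * hmax := by positivity
  rw [estimator, estimator, ← Finset.sum_sub_distrib]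
  calc _ ≤ ∑ k, |(M : ℝ) ^ (nbr k).card * h k (fun i => x i) -
          (M : ℝ) ^ (nbr k).card * h k (fun i => y i)| := Finset.abs_sum_le_sum_abs _ _
    _ ≤ ∑ k, if j ∈ nbr k then 2 * (M : ℝ) ^ L * hmax else 0 := by
        refine Finset.sum_le_sum fun k _ => ?_
        split_ifs with hj
        · rw [← mul_sub, abs_mul, abs_of_nonneg (by positivity : (0 : ℝ) ≤ M ^ (nbr k).card)]
          calc _ ≤ (M : ℝ) ^ L * (hmax + hmax) :=
                mul_le_mul (pow_le_pow_right₀ hM' (hcard k))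
                  ((abs_sub _ _).trans (add_le_add (hb _ _) (hb _ _))) (abs_nonneg _)
                  (by positivity)
            _ = _ := by ring
        · have : (fun i : nbr k => x i) = fun i : nbr k => y i :=
            funext fun i => hxy i fun hi => hj (hi ▸ i.2)
          rw [this, sub_self, abs_zero]
    _ = ((Finset.univ.filter fun k => j ∈ nbr k).card : ℝ) * (2 * (M : ℝ) ^ L * hmax) := by
        rw [← Finset.sum_filter, Finset.sum_const, nsmul_eq_mul]
    _ ≤ L * (2 * (M : ℝ) ^ L * hmax) :=
        mul_le_mul_of_nonneg_right (by exact_mod_cast hoverlap j) hML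
    _ = _ := by ring

/-- `N ε_s` is a lower bound of the energy of every separable state. -/
theorem mul_sepEnergy_le (hN : 0 < N) (hM : 0 < M) (hE : IsMeasurement E)
    (hh : IsExpansion E nbr A h) {ρ : Matrix (Fin N → Fin d) (Fin N → Fin d) ℂ}
    (hρ : ρ ∈ separableStates N d) :
    N * sepEnergy (hamiltonian nbr A) ≤ (hamiltonian nbr A * ρ).trace.re := by
  have hN' : (N : ℝ) ≠ 0 := by exact_mod_cast hN.ne'
  rw [sepEnergy, ← mul_assoc, mul_one_div_cancel hN', one_mul]
  refine csInf_le ⟨-∑ x, |estimator nbr h x|, ?_⟩ ⟨ρ, hρ, rfl⟩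
  rintro _ ⟨σ, hσ, rfl⟩
  have hconv : Convex ℝ {σ : Matrix (Fin N → Fin d) (Fin N → Fin d) ℂ |
      -∑ x, |estimator nbr h x| ≤ (hamiltonian nbr A * σ).trace.re} :=
    convex_halfSpace_ge (𝕜 := ℝ) ⟨fun a b => by simp [Matrix.mul_add], fun c a => by simp⟩ _
  refine convexHull_min ?_ hconv hσ
  rintro _ ⟨r, hr, rfl⟩
  rw [Set.mem_ofPred_eq, trace_hamiltonian_mul_tensorOp hM hE hh hr, ← Finset.sum_neg_distrib]
  refine Finset.sum_le_sum fun x _ => ?_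
  have h0 : 0 ≤ ∏ j, localProb (E j) (r j) (x j) :=
    Finset.prod_nonneg fun j _ => localProb_nonneg hE (hr j).1 j _
  have h1 : ∏ j, localProb (E j) (r j) (x j) ≤ 1 :=
    Finset.prod_le_one (fun j _ => localProb_nonneg hE (hr j).1 j _) fun j _ => by
      rw [← sum_localProb hM hE (hr j).2 j]
      exact Finset.single_le_sum (fun a _ => localProb_nonneg hE (hr j).1 j a)
        (Finset.mem_univ (x j))
  calc _ ≤ -((∏ j, localProb (E j) (r j) (x j)) * |estimator nbr h x|) :=
        neg_le_neg (mul_le_of_le_one_left (abs_nonneg _) h1)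
    _ = (∏ j, localProb (E j) (r j) (x j)) * -|estimator nbr h x| := by ring
    _ ≤ _ := mul_le_mul_of_nonneg_left (neg_abs_le _) h0

theorem convex_setOf_eventProb_le (E : Fin N → Fin M → Fin D → Matrix (Fin d) (Fin d) ℂ)
    (S : Set (Fin N → Fin M × Fin D)) (c : ℝ) : Convex ℝ {ρ | eventProb E ρ S ≤ c} := by
  classical
  refine convex_halfSpace_le (𝕜 := ℝ) ⟨fun a b => ?_, fun t a => ?_⟩ _
  · simp only [eventProb, ← Finset.sum_add_distrib, Set.indicator_apply]
    refine Finset.sum_congr rfl fun x _ => ?_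
    split_ifs <;> simp [runProb, Matrix.add_mul, mul_add]
  · simp only [eventProb, smul_eq_mul, Finset.mul_sum, Set.indicator_apply]
    refine Finset.sum_congr rfl fun x _ => ?_
    split_ifs <;> simp [runProb, mul_left_comm]

end SingleCopy

theorem mainTheorem3 {N L M D d : ℕ} (hN : 0 < N) (hL : 0 < L) (hM : 0 < M) (hd : 0 < d)
    (E : Fin N → Fin M → Fin D → Matrix (Fin d) (Fin d) ℂ)
    (hE : SingleCopy.IsMeasurement E) (hT : SingleCopy.TomographicallyComplete E)
    (nbr : Fin N → Finset (Fin N))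
    (hcard : ∀ k, (nbr k).card ≤ L)
    (hoverlap : ∀ j, (Finset.univ.filter fun k => j ∈ nbr k).card ≤ L)
    (A : (k : Fin N) → Matrix (nbr k → Fin d) (nbr k → Fin d) ℂ)
    (hA : ∀ k, (A k).IsHermitian) :
    (∃ h : (k : Fin N) → (nbr k → Fin M × Fin D) → ℝ, SingleCopy.IsExpansion E nbr A h) ∧
    ∀ h : (k : Fin N) → (nbr k → Fin M × Fin D) → ℝ, SingleCopy.IsExpansion E nbr A h →
      ∀ hmax : ℝ, 0 < hmax → (∀ k x, |h k x| ≤ hmax) →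
        0 < SingleCopy.kappa M L hmax ∧
        ∀ δ : ℝ, 0 < δ → ∀ ρ ∈ SingleCopy.separableStates N d,
          SingleCopy.eventProb E ρ {x | SingleCopy.cost nbr A h δ x = 1} ≤
            Real.exp (-((N : ℝ) * SingleCopy.kappa M L hmax ^ 2 * δ ^ 2)) := by
  constructor
  · choose h hh using fun k => SingleCopy.exists_eq_sum_smul_tensorOp
      (B := fun (j : nbr k) (x : Fin M × Fin D) => E j x.1 x.2)
      (fun j x => ((hE j x.1).1 x.2).isHermitian)
      (fun j C hC => by
        obtain ⟨a, ha⟩ := hT j C hC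
        exact ⟨fun x => a x.1 x.2, by rw [ha, Fintype.sum_prod_type]⟩) (hA k)
    exact ⟨h, hh⟩
  intro h hh hmax hmax0 hb
  have hN' : (0 : ℝ) < N := by exact_mod_cast hN
  have hM' : (0 : ℝ) < M := by exact_mod_cast hM
  have hL' : (0 : ℝ) < L := by exact_mod_cast hL
  refine ⟨by rw [SingleCopy.kappa]; positivity, fun δ hδ ρ hρ => ?_⟩
  refine convexHull_min ?_ (SingleCopy.convex_setOf_eventProb_le E _ _) hρ
  rintro _ ⟨r, hr, rfl⟩
  have hE_le := SingleCopy.mul_sepEnergy_le hN hM hE hh (subset_convexHull ℝ _ ⟨r, hr, rfl⟩)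
  rw [SingleCopy.trace_hamiltonian_mul_tensorOp hM hE hh hr] at hE_le
  rw [Set.mem_ofPred_eq, SingleCopy.eventProb,
    funext (SingleCopy.runProb_tensorOp hM hE fun j => (hr j).1)]
  refine (SingleCopy.sum_indicator_prod_le_exp hN (c := 2 * (M : ℝ) ^ L * L * hmax)
    (by positivity) (fun j => SingleCopy.localProb_nonneg hE (hr j).1 j)
    (fun j => SingleCopy.sum_localProb hM hE (hr j).2 j)
    (SingleCopy.abs_estimator_sub_le hM hcard hoverlap hmax0.le hb)
    (mul_nonneg hN'.le hδ.le) fun x hx => ?_).trans_eq ?_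
  · have hx' : SingleCopy.estimator nbr h x ≤
        N * (SingleCopy.sepEnergy (SingleCopy.hamiltonian nbr A) - δ) := by
      by_contra hlt
      simp [SingleCopy.cost, hlt] at hx
    linarith
  · have hκ : SingleCopy.kappa M L hmax ^ 2 = 1 / (2 * ((M : ℝ) ^ L * L * hmax) ^ 2) := by
      rw [SingleCopy.kappa, div_pow, one_pow, mul_assoc, mul_assoc, mul_pow,
        Real.sq_sqrt zero_le_two, ← mul_assoc]
    rw [hκ]
    congr 2
    field_simp
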